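/- For a discrete group $\Gamma$, let $C^*(\Gamma)$ denote its group $C^*$-algebra, that is, the enveloping $C^*$-algebra of the convolution algebra $\ell^1(\Gamma)$ (the Hausdorff completion of $\ell^1(\Gamma)$ with respect to the seminorm $\|f\|=\sup_\pi\|\pi(f)\|$, where $\pi$ runs through the nondegenerate $*$-representations of $\ell^1(\Gamma)$ on Hilbert spaces). Let $\mathcal U(C^*(\Gamma))$ be the group of unitary elements of $C^*(\Gamma)$ with the norm topology and, for $\Gamma$ Abelian, let $\widehat\Gamma$ be the compact group of characters $\Gamma\to\mathbb T$ with the topology of pointwise convergence. Let $T_1$ and $T_2$ be countable (finite or countably infinite) torsion discrete Abelian groups. Then the following assertions are equivalent: 1. The group $C^*$-algebras $C^*(T_1)$ and $C^*(T_2)$ are isomorphic as $C^*$-algebras. 2. The unitary groups $\mathcal U(C^*(T_1))$ and $\mathcal U(C^*(T_2))$ are isomorphic as topological groups. 3. The compact groups $\widehat{T_1}$ and $\widehat{T_2}$ are homeomorphic (as topological spaces). 4. $T_1$ and $T_2$ have the same cardinality. -/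

import Mathlib

universe u

/-! ### The convolution algebra `ℓ¹(Γ)` of a discrete group -/

/-- The Banach space `ℓ¹(Γ)`, i.e. `L¹(Γ)` for the counting (Haar) measure of the discrete
group `Γ`.  It carries the convolution product below. -/
def GroupL1 (Γ : Type u) : Type u := lp (fun _ : Γ => ℂ) 1

namespace GroupL1

noncomputable section

section Banach

variable {Γ : Type u}

instance : NormedAddCommGroup (GroupL1 Γ) :=
  inferInstanceAs (NormedAddCommGroup (lp (fun _ : Γ => ℂ) 1))

instance : NormedSpace ℂ (GroupL1 Γ) :=
  inferInstanceAs (NormedSpace ℂ (lp (fun _ : Γ => ℂ) 1))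

instance : CompleteSpace (GroupL1 Γ) :=
  inferInstanceAs (CompleteSpace (lp (fun _ : Γ => ℂ) 1))

/-- The function `Γ → ℂ` underlying an element of `ℓ¹(Γ)`. -/
def coeff (f : GroupL1 Γ) : Γ → ℂ := (show lp (fun _ : Γ => ℂ) 1 from f : ∀ _ : Γ, ℂ)

theorem ext {f g : GroupL1 Γ} (h : ∀ x, f.coeff x = g.coeff x) : f = g :=
  lp.ext (funext h)

theorem summable_norm (f : GroupL1 Γ) : Summable fun x => ‖f.coeff x‖ := by
  have h := (memℓp_gen_iff (p := 1) (by simp)).1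
    (lp.memℓp (show lp (fun _ : Γ => ℂ) 1 from f))
  simpa using! h

/-- The element of `ℓ¹(Γ)` given by an absolutely summable function. -/
def mk (f : Γ → ℂ) (hf : Summable fun x => ‖f x‖) : GroupL1 Γ :=
  (⟨f, memℓp_gen (by simpa using hf)⟩ : lp (fun _ : Γ => ℂ) 1)

@[simp] theorem coeff_mk (f : Γ → ℂ) (hf) (x : Γ) : (mk f hf).coeff x = f x := rfl

@[simp] theorem coeff_add (f g : GroupL1 Γ) (x : Γ) :
    (f + g).coeff x = f.coeff x + g.coeff x := rfl

@[simp] theorem coeff_zero (x : Γ) : (0 : GroupL1 Γ).coeff x = 0 := rfl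

@[simp] theorem coeff_smul (c : ℂ) (f : GroupL1 Γ) (x : Γ) :
    (c • f).coeff x = c * f.coeff x := rfl

theorem norm_eq (f : GroupL1 Γ) : ‖f‖ = ∑' x, ‖f.coeff x‖ := by
  have h := lp.norm_eq_tsum_rpow (p := 1) (by simp) (show lp (fun _ : Γ => ℂ) 1 from f)
  simpa using! h

theorem norm_coeff_le (f : GroupL1 Γ) (x : Γ) : ‖f.coeff x‖ ≤ ‖f‖ := by
  rw [norm_eq]
  exact f.summable_norm.le_tsum x fun _ _ => norm_nonneg _

end Banach

variable {Γ : Type u} [Group Γ]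

theorem summable_prod (f g : GroupL1 Γ) :
    Summable fun p : Γ × Γ => ‖f.coeff p.1 * g.coeff (p.1⁻¹ * p.2)‖ := by
  have h : Summable fun p : Γ × Γ => ‖f.coeff p.1‖ * ‖g.coeff p.2‖ :=
    f.summable_norm.mul_of_nonneg g.summable_norm (fun _ => norm_nonneg _)
      (fun _ => norm_nonneg _)
  let e : Γ × Γ ≃ Γ × Γ := Equiv.prodShear (Equiv.refl Γ) fun y => Equiv.mulLeft y⁻¹
  have h2 := (e.summable_iff).2 h
  refine h2.congr fun p => ?_
  simp [e, Equiv.prodShear]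

theorem summable_conv (f g : GroupL1 Γ) (x : Γ) :
    Summable fun y => f.coeff y * g.coeff (y⁻¹ * x) := by
  refine Summable.of_norm_bounded (g := fun y => ‖f.coeff y‖ * ‖g‖)
    (f.summable_norm.mul_right _) fun y => ?_
  rw [norm_mul]
  exact mul_le_mul_of_nonneg_left (g.norm_coeff_le _) (norm_nonneg _)

theorem summable_norm_conv (f g : GroupL1 Γ) :
    Summable fun x => ‖∑' y, f.coeff y * g.coeff (y⁻¹ * x)‖ := by
  have h := (summable_prod f g).prod_symm
  refine Summable.of_nonneg_of_le (fun _ => norm_nonneg _) (fun x => ?_) h.prod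
  exact norm_tsum_le_tsum_norm (f.summable_conv g x).norm

/-- Convolution: `(f * g)(x) = ∑_y f(y) g(y⁻¹ x)`. -/
instance : Mul (GroupL1 Γ) where
  mul f g := mk (fun x => ∑' y, f.coeff y * g.coeff (y⁻¹ * x)) (summable_norm_conv f g)

theorem coeff_mul (f g : GroupL1 Γ) (x : Γ) :
    (f * g).coeff x = ∑' y, f.coeff y * g.coeff (y⁻¹ * x) := rfl

/-- The unit of the convolution algebra is the point mass at the identity element. -/
instance : One (GroupL1 Γ) where
  one := mk (Set.indicator {1} fun _ => 1) (by
    refine summable_of_ne_finset_zero (s := {1}) fun x hx => ?_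
    simp at hx
    simp [hx])

theorem coeff_one (x : Γ) : (1 : GroupL1 Γ).coeff x = Set.indicator {1} (fun _ => 1) x := rfl

/-- The involution `f*(x) = conj f(x⁻¹)`. -/
instance : Star (GroupL1 Γ) where
  star f := mk (fun x => star (f.coeff x⁻¹)) (by
    simpa using! ((Equiv.inv Γ).summable_iff).2 f.summable_norm)

theorem coeff_star (f : GroupL1 Γ) (x : Γ) : (star f).coeff x = star (f.coeff x⁻¹) := rfl

protected theorem mul_assoc (f g h : GroupL1 Γ) : f * g * h = f * (g * h) := by
  refine ext fun x => ?_
  have hs : Summable fun p : Γ × Γ =>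
      f.coeff p.1 * g.coeff (p.1⁻¹ * p.2) * h.coeff (p.2⁻¹ * x) := by
    refine Summable.of_norm_bounded
      (g := fun p : Γ × Γ => ‖f.coeff p.1 * g.coeff (p.1⁻¹ * p.2)‖ * ‖h‖)
      ((summable_prod f g).mul_right _) fun p => ?_
    rw [norm_mul]
    exact mul_le_mul_of_nonneg_left (h.norm_coeff_le _) (norm_nonneg _)
  calc (f * g * h).coeff x
      = ∑' y, ∑' z, f.coeff z * g.coeff (z⁻¹ * y) * h.coeff (y⁻¹ * x) := by
        rw [coeff_mul]
        refine tsum_congr fun y => ?_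
        rw [coeff_mul, tsum_mul_right]
    _ = ∑' z, ∑' y, f.coeff z * g.coeff (z⁻¹ * y) * h.coeff (y⁻¹ * x) :=
        Summable.tsum_comm hs
    _ = (f * (g * h)).coeff x := by
        rw [coeff_mul]
        refine tsum_congr fun z => ?_
        rw [coeff_mul, ← tsum_mul_left, ← (Equiv.mulLeft z).tsum_eq]
        refine tsum_congr fun w => ?_
        simp [mul_assoc]

protected theorem one_mul (f : GroupL1 Γ) : 1 * f = f := by
  refine ext fun x => ?_
  rw [coeff_mul, tsum_eq_single 1]
  · simp [coeff_one]
  · intro y hy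
    simp [coeff_one, hy]

protected theorem mul_one (f : GroupL1 Γ) : f * 1 = f := by
  refine ext fun x => ?_
  rw [coeff_mul, tsum_eq_single x]
  · simp [coeff_one]
  · intro y hy
    have : y⁻¹ * x ≠ 1 := fun h => hy (inv_mul_eq_one.1 h)
    simp [coeff_one, this]

instance : Ring (GroupL1 Γ) where
  __ : AddCommGroup (GroupL1 Γ) := inferInstance
  mul_assoc := GroupL1.mul_assoc
  one_mul := GroupL1.one_mul
  mul_one := GroupL1.mul_one
  zero_mul f := ext fun x => by simp [coeff_mul]
  mul_zero f := ext fun x => by simp [coeff_mul]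
  left_distrib f g h := ext fun x => by
    simp only [coeff_mul, coeff_add, mul_add]
    exact (f.summable_conv g x).tsum_add (f.summable_conv h x)
  right_distrib f g h := ext fun x => by
    simp only [coeff_mul, coeff_add, add_mul]
    exact (f.summable_conv h x).tsum_add (g.summable_conv h x)

protected theorem norm_mul_le (f g : GroupL1 Γ) : ‖f * g‖ ≤ ‖f‖ * ‖g‖ := by
  have h := summable_prod f g
  have h' := h.prod_symm
  calc ‖f * g‖ = ∑' x, ‖∑' y, f.coeff y * g.coeff (y⁻¹ * x)‖ := norm_eq _
    _ ≤ ∑' x, ∑' y, ‖f.coeff y * g.coeff (y⁻¹ * x)‖ :=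
        (summable_norm_conv f g).tsum_le_tsum
          (fun x => norm_tsum_le_tsum_norm (f.summable_conv g x).norm) h'.prod
    _ = ∑' y, ∑' x, ‖f.coeff y * g.coeff (y⁻¹ * x)‖ := Summable.tsum_comm h
    _ = ∑' y, ‖f.coeff y‖ * ‖g‖ := by
        refine tsum_congr fun y => ?_
        simp only [norm_mul]
        rw [tsum_mul_left, norm_eq g, ← (Equiv.mulLeft y⁻¹).tsum_eq fun z => ‖g.coeff z‖]
        rfl
    _ = ‖f‖ * ‖g‖ := by rw [tsum_mul_right, norm_eq f]

instance : NormedRing (GroupL1 Γ) where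
  __ : Ring (GroupL1 Γ) := inferInstance
  __ : NormedAddCommGroup (GroupL1 Γ) := inferInstance
  norm_mul_le := GroupL1.norm_mul_le

instance : Algebra ℂ (GroupL1 Γ) :=
  Algebra.ofModule
    (fun c f g => ext fun x => by
      simp only [coeff_mul, coeff_smul, mul_assoc, tsum_mul_left])
    (fun c f g => ext fun x => by
      simp only [coeff_mul, coeff_smul, mul_left_comm _ c, tsum_mul_left])

instance : NormedAlgebra ℂ (GroupL1 Γ) where
  norm_smul_le c f := norm_smul_le c f

instance : NormOneClass (GroupL1 Γ) where
  norm_one := by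
    rw [norm_eq, tsum_eq_single 1]
    · simp [coeff_one]
    · intro y hy
      simp [coeff_one, hy]

instance : StarRing (GroupL1 Γ) where
  star_involutive f := ext fun x => by simp [coeff_star]
  star_add f g := ext fun x => by simp [coeff_star]
  star_mul f g := ext fun x => by
    rw [coeff_star, coeff_mul, coeff_mul, tsum_star, ← (Equiv.mulLeft x⁻¹).tsum_eq]
    refine tsum_congr fun y => ?_
    simp [coeff_star, mul_comm]

instance : StarModule ℂ (GroupL1 Γ) where
  star_smul c f := ext fun x => by simp [coeff_star]

instance : NormedStarGroup (GroupL1 Γ) where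
  norm_star_le f := by
    rw [norm_eq, norm_eq, ← (Equiv.inv Γ).tsum_eq]
    simp [coeff_star]

end

end GroupL1

/-! ### The enveloping C⋆-algebra of a unital involutive Banach algebra -/

/-- A (unital, i.e. nondegenerate) ⋆-representation of `A` on a complex Hilbert space. The Hilbert
space lies in the universe of `A`; since every cyclic representation of `A` lives on a completion
of a quotient of `A`, this is no restriction for the norms `‖π a‖`. -/
structure HilbertRep (A : Type u) [Ring A] [Algebra ℂ A] [StarRing A] where
  /-- the underlying Hilbert space -/
  H : Type u
  [normedAddCommGroup : NormedAddCommGroup H]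
  [innerProductSpace : InnerProductSpace ℂ H]
  [completeSpace : CompleteSpace H]
  /-- the representation by bounded operators -/
  π : A →⋆ₐ[ℂ] (H →L[ℂ] H)

attribute [instance] HilbertRep.normedAddCommGroup HilbertRep.innerProductSpace
  HilbertRep.completeSpace

/-- Every ⋆-representation of an involutive Banach algebra is contractive. -/
theorem HilbertRep.norm_le {A : Type u} [NormedRing A] [NormedAlgebra ℂ A] [CompleteSpace A]
    [NormOneClass A] [StarRing A] [NormedStarGroup A] (ρ : HilbertRep A) (a : A) :
    ‖ρ.π a‖ ≤ ‖a‖ := by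
  have h1 : spectralRadius ℂ (star (ρ.π a) * ρ.π a) ≤ (‖star a * a‖₊ : ENNReal) := by
    rw [← map_star, ← map_mul]
    exact (iSup_le_iSup_of_subset (AlgHom.spectrum_apply_subset ρ.π _)).trans
      (spectrum.spectralRadius_le_nnnorm (𝕜 := ℂ) (star a * a))
  have h2 : ‖ρ.π a‖ ^ 2 ≤ ‖star a * a‖ := by
    rw [← CStarAlgebra.toReal_spectralRadius_star_mul_self_eq_norm_sq]
    simpa using ENNReal.toReal_mono ENNReal.coe_ne_top h1
  have h3 : ‖star a * a‖ ≤ ‖a‖ ^ 2 := by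
    simpa [sq] using norm_mul_le (star a) a
  exact le_of_sq_le_sq (h2.trans h3) (norm_nonneg a)

noncomputable section

section Enveloping

variable (A : Type u) [NormedRing A] [NormedAlgebra ℂ A] [CompleteSpace A] [NormOneClass A]
  [StarRing A] [NormedStarGroup A]

/-- The seminorm `a ↦ sup_π ‖π a‖`, where `π` runs through the ⋆-representations of `A` on
Hilbert spaces. -/
def envelopingSeminorm : RingSeminorm A where
  toFun a := ⨆ ρ : HilbertRep A, ‖ρ.π a‖
  map_zero' := by simp
  add_le' a b := by
    refine Real.iSup_le (fun ρ => ?_) (add_nonneg (Real.iSup_nonneg fun _ => norm_nonneg _)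
      (Real.iSup_nonneg fun _ => norm_nonneg _))
    rw [map_add]
    exact (norm_add_le _ _).trans (add_le_add
      (le_ciSup (f := fun ρ : HilbertRep A => ‖ρ.π a‖)
        ⟨‖a‖, by rintro _ ⟨ρ, rfl⟩; exact ρ.norm_le a⟩ ρ)
      (le_ciSup (f := fun ρ : HilbertRep A => ‖ρ.π b‖)
        ⟨‖b‖, by rintro _ ⟨ρ, rfl⟩; exact ρ.norm_le b⟩ ρ))
  neg' a := by simp
  mul_le' a b := by
    refine Real.iSup_le (fun ρ => ?_) (mul_nonneg (Real.iSup_nonneg fun _ => norm_nonneg _)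
      (Real.iSup_nonneg fun _ => norm_nonneg _))
    rw [map_mul]
    exact (norm_mul_le _ _).trans (mul_le_mul
      (le_ciSup (f := fun ρ : HilbertRep A => ‖ρ.π a‖)
        ⟨‖a‖, by rintro _ ⟨ρ, rfl⟩; exact ρ.norm_le a⟩ ρ)
      (le_ciSup (f := fun ρ : HilbertRep A => ‖ρ.π b‖)
        ⟨‖b‖, by rintro _ ⟨ρ, rfl⟩; exact ρ.norm_le b⟩ ρ)
      (norm_nonneg _) (Real.iSup_nonneg fun _ => norm_nonneg _))

variable {A} in
theorem envelopingSeminorm_apply (a : A) :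
    envelopingSeminorm A a = ⨆ ρ : HilbertRep A, ‖ρ.π a‖ := rfl

variable {A} in
theorem HilbertRep.norm_le_envelopingSeminorm (ρ : HilbertRep A) (a : A) :
    ‖ρ.π a‖ ≤ envelopingSeminorm A a :=
  le_ciSup (f := fun ρ : HilbertRep A => ‖ρ.π a‖)
    ⟨‖a‖, by rintro _ ⟨ρ, rfl⟩; exact ρ.norm_le a⟩ ρ

variable {A} in
theorem envelopingSeminorm_star (a : A) :
    envelopingSeminorm A (star a) = envelopingSeminorm A a := by
  simp only [envelopingSeminorm_apply, map_star, norm_star]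

variable {A} in
theorem envelopingSeminorm_mul_self_le (a : A) :
    envelopingSeminorm A a * envelopingSeminorm A a ≤ envelopingSeminorm A (star a * a) := by
  have h : envelopingSeminorm A a ≤ √(envelopingSeminorm A (star a * a)) := by
    refine Real.iSup_le (fun ρ => Real.le_sqrt_of_sq_le ?_) (Real.sqrt_nonneg _)
    have := ρ.norm_le_envelopingSeminorm (star a * a)
    rwa [map_mul, map_star, CStarRing.norm_star_mul_self, ← sq] at this
  calc envelopingSeminorm A a * envelopingSeminorm A a
      ≤ √(envelopingSeminorm A (star a * a)) * √(envelopingSeminorm A (star a * a)) :=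
        mul_le_mul h h (apply_nonneg _ _) (Real.sqrt_nonneg _)
    _ = _ := Real.mul_self_sqrt (apply_nonneg _ _)

/-- The ⋆-algebra `A`, equipped with the seminorm `envelopingSeminorm A` instead of its own
norm. -/
def EnvelopingPre (A : Type u) : Type u := A

namespace EnvelopingPre

instance : SeminormedRing (EnvelopingPre A) := (envelopingSeminorm A).toSeminormedRing

instance : Algebra ℂ (EnvelopingPre A) := inferInstanceAs (Algebra ℂ A)

instance : StarRing (EnvelopingPre A) := inferInstanceAs (StarRing A)

variable {A} in
theorem norm_def (a : EnvelopingPre A) : ‖a‖ = envelopingSeminorm A a := rfl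

instance : NormedAlgebra ℂ (EnvelopingPre A) where
  norm_smul_le c a := by
    change (⨆ ρ : HilbertRep A, ‖ρ.π (c • (show A from a))‖) ≤
      ‖c‖ * ⨆ ρ : HilbertRep A, ‖ρ.π (show A from a)‖
    rw [Real.mul_iSup_of_nonneg (norm_nonneg c)]
    refine le_of_eq (iSup_congr fun ρ => ?_)
    exact (congrArg norm (map_smul ρ.π c (show A from a))).trans (norm_smul c _)

instance : NormedStarGroup (EnvelopingPre A) where
  norm_star_le a := (envelopingSeminorm_star (show A from a)).le

end EnvelopingPre

/-- The enveloping C⋆-algebra of the involutive Banach algebra `A`: the Hausdorff completion of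
`A` with respect to the seminorm `a ↦ sup_π ‖π a‖`, where `π` runs through the
⋆-representations of `A` on Hilbert spaces. -/
def EnvelopingCStarAlgebra : Type u := UniformSpace.Completion (EnvelopingPre A)

namespace EnvelopingCStarAlgebra

open UniformSpace

instance : NormedRing (EnvelopingCStarAlgebra A) :=
  inferInstanceAs (NormedRing (Completion (EnvelopingPre A)))

instance : CompleteSpace (EnvelopingCStarAlgebra A) :=
  inferInstanceAs (CompleteSpace (Completion (EnvelopingPre A)))

instance : Algebra ℂ (EnvelopingCStarAlgebra A) :=
  inferInstanceAs (Algebra ℂ (Completion (EnvelopingPre A)))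

instance : NormedAlgebra ℂ (EnvelopingCStarAlgebra A) where
  norm_smul_le c x := norm_smul_le c (show Completion (EnvelopingPre A) from x)

variable {A} in
/-- The canonical map from `A` to its enveloping C⋆-algebra. -/
def of (a : A) : EnvelopingCStarAlgebra A := Completion.coe' (show EnvelopingPre A from a)

variable {A} in
theorem norm_of (a : A) : ‖of a‖ = ⨆ ρ : HilbertRep A, ‖ρ.π a‖ :=
  Completion.norm_coe (show EnvelopingPre A from a)

theorem denseRange_of : DenseRange (of : A → EnvelopingCStarAlgebra A) :=
  Completion.denseRange_coe (α := EnvelopingPre A)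

/-- The involution extends that of `A` by continuity. -/
instance : Star (EnvelopingCStarAlgebra A) where
  star := Completion.map (star : EnvelopingPre A → EnvelopingPre A)

theorem continuous_star' : Continuous (star : EnvelopingCStarAlgebra A → _) :=
  Completion.continuous_map (α := EnvelopingPre A)

variable {A} in
theorem star_of (a : A) : star (of a) = of (star a) :=
  Completion.map_coe (α := EnvelopingPre A) (β := EnvelopingPre A)
    (star_isometry (E := EnvelopingPre A)).uniformContinuous _

variable {A} in
theorem of_add (a b : A) : of (a + b) = of a + of b :=
  Completion.coe_add (α := EnvelopingPre A) a b

variable {A} in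
theorem of_mul (a b : A) : of (a * b) = of a * of b :=
  Completion.coe_mul (α := EnvelopingPre A) a b

variable {A} in
theorem of_smul (c : ℂ) (a : A) : of (c • a) = c • of a :=
  Completion.coe_smul (X := EnvelopingPre A) c a

instance : StarRing (EnvelopingCStarAlgebra A) where
  star_involutive x := by
    have hc := continuous_star' A
    refine (denseRange_of A).induction_on x (isClosed_eq (hc.comp hc) continuous_id) fun a => ?_
    rw [star_of, star_of, star_star]
  star_add x y := by
    have hc := continuous_star' A
    refine (denseRange_of A).induction_on₂ (p := fun x y => star (x + y) = star x + star y)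
      (isClosed_eq (hc.comp continuous_add)
        ((hc.comp continuous_fst).add (hc.comp continuous_snd))) (fun a b => ?_) x y
    rw [← of_add, star_of, star_of, star_of, star_add, of_add]
  star_mul x y := by
    have hc := continuous_star' A
    refine (denseRange_of A).induction_on₂ (p := fun x y => star (x * y) = star y * star x)
      (isClosed_eq (hc.comp continuous_mul)
        ((hc.comp continuous_snd).mul (hc.comp continuous_fst))) (fun a b => ?_) x y
    rw [← of_mul, star_of, star_of, star_of, star_mul, of_mul]

instance [StarModule ℂ A] : StarModule ℂ (EnvelopingCStarAlgebra A) where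
  star_smul c x := by
    have hc := continuous_star' A
    refine (denseRange_of A).induction_on x
      (isClosed_eq (hc.comp (continuous_const_smul c)) (hc.const_smul (star c))) fun a => ?_
    rw [← of_smul, star_of, star_of, star_smul, of_smul]

instance : CStarRing (EnvelopingCStarAlgebra A) where
  norm_mul_self_le x := by
    have hc := continuous_star' A
    refine (denseRange_of A).induction_on x
      (isClosed_le (continuous_norm.mul continuous_norm)
        (continuous_norm.comp (hc.mul continuous_id))) fun a => ?_
    rw [star_of, ← of_mul, norm_of, norm_of]
    exact envelopingSeminorm_mul_self_le a

instance [StarModule ℂ A] : CStarAlgebra (EnvelopingCStarAlgebra A) where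

end EnvelopingCStarAlgebra

end Enveloping

/-- The group C⋆-algebra `C⋆(Γ)` of a discrete group `Γ`: the enveloping C⋆-algebra of the
convolution algebra `ℓ¹(Γ)`. -/
abbrev GroupCStarAlgebra (Γ : Type u) [Group Γ] : Type u := EnvelopingCStarAlgebra (GroupL1 Γ)

end

/-! For an Abelian group, Gelfand duality identifies `C⋆(T)` with the continuous functions on its
character space, and that space is the dual group: a character of `C⋆(T)` is determined by its
values on the point masses, and every unitary character of `T` extends
(`GroupCStarAlgebra.starAlgEquivContinuousMap`). The algebra therefore depends only on the
topological space `PontryaginDual T`.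

Torsion makes the dual totally disconnected and countability makes it second countable. If `T` is
infinite, the dual is also without isolated points, hence a Cantor space by Brouwer's theorem
(`nonempty_homeomorph_cantorSpace`). If `T` is finite, the dual is discrete with as many points as
`T`. In both cases the cardinality of `T` fixes the dual up to homeomorphism.

Conversely, the abstract group of unitaries recovers the cardinality. Unitaries with square one in
`C(X, ℂ)` take the values `1` and `-1`, so they correspond to the clopen subsets of `X`
(`unitarySqEqOneEquivClopens`). A finite dual with `n` points has `2 ^ n` of these, an infinite one
has infinitely many, and all infinite countable groups are equipotent. -/

/-! ### Brouwer's characterization of the Cantor space -/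

section Cantor

open Set TopologicalSpace

variable {X : Type*} [TopologicalSpace X]

/-- A nonempty open set in a totally disconnected compact Hausdorff space without isolated points
is cut by a clopen set into two nonempty parts; if possible, by the prescribed clopen set `C`. -/
theorem exists_isClopen_splitting [CompactSpace X] [T2Space X] [TotallyDisconnectedSpace X]
    (hX : ∀ x : X, ¬IsOpen ({x} : Set X)) {C : Set X} (hC : IsClopen C) {U : Set X}
    (hU : IsOpen U) (hne : U.Nonempty) :
    ∃ V : Set X, IsClopen V ∧ (U ∩ V).Nonempty ∧ (U \ V).Nonempty ∧
      ((∀ x ∈ U, x ∈ V ↔ x ∈ C) ∨ (∀ x ∈ U, ∀ y ∈ U, x ∈ C ↔ y ∈ C)) := by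
  by_cases h : (U ∩ C).Nonempty ∧ (U \ C).Nonempty
  · exact ⟨C, hC, h.1, h.2, Or.inl fun _ _ => Iff.rfl⟩
  obtain ⟨x, hx⟩ := hne
  obtain ⟨y, hy, hyx⟩ : ∃ y ∈ U, y ≠ x := by
    by_contra! hsub
    exact hX x (eq_singleton_iff_unique_mem.2 ⟨hx, hsub⟩ ▸ hU)
  -- Here `C` does not cut `U`, so any proper clopen cut will do: all of `U` lies on one side of
  -- `C`.
  obtain ⟨V, hV, hxV, hyV⟩ := exists_isClopen_of_totally_separated hyx.symm
  refine ⟨V, hV, ⟨x, hx, hxV⟩, ⟨y, hy, hyV⟩, Or.inr fun a ha b hb => ?_⟩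
  by_contra hab
  apply h
  by_cases haC : a ∈ C
  · exact ⟨⟨a, ha, haC⟩, ⟨b, hb, fun hbC => hab (iff_of_true haC hbC)⟩⟩
  · exact ⟨⟨b, hb, by tauto⟩, ⟨a, ha, haC⟩⟩

end Cantor

/-! ### Binary schemes of sets and their branches -/

namespace CantorScheme

open Set

variable {X : Type*} (V : ℕ → Set X → Set X)

open Classical in
/-- The set selected by the first `n` digits of `b`, where `V k U` is used to cut the set `U`
obtained from the first `k` digits. -/
def piece (b : ℕ → Bool) : ℕ → Set X
  | 0 => univ
  | n + 1 => if b n then piece b n ∩ V n (piece b n) else piece b n \ V n (piece b n)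

open Classical in
/-- The piece of level `n` that contains `x`. -/
def pieceOf (x : X) : ℕ → Set X
  | 0 => univ
  | n + 1 => if x ∈ V n (pieceOf x n) then pieceOf x n ∩ V n (pieceOf x n)
      else pieceOf x n \ V n (pieceOf x n)

open Classical in
/-- The digits of the branch along which `x` lies. -/
noncomputable def branch (x : X) (n : ℕ) : Bool := decide (x ∈ V n (pieceOf V x n))

theorem mem_pieceOf (x : X) (n : ℕ) : x ∈ pieceOf V x n := by
  induction n with
  | zero => trivial
  | succ n ih => rw [pieceOf]; split_ifs with h <;> exact ⟨ih, h⟩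

/-- Pieces of one level partition the space. This makes each digit of `branch` locally constant when
the pieces and cuts are clopen. -/
theorem pieceOf_eq_of_mem {x y : X} {n : ℕ} (h : y ∈ pieceOf V x n) :
    pieceOf V y n = pieceOf V x n := by
  induction n with
  | zero => rfl
  | succ n ih =>
    rw [pieceOf] at h
    have hy : y ∈ pieceOf V x n := by split_ifs at h <;> exact h.1
    rw [pieceOf, pieceOf, ih hy]
    split_ifs at h with hx
    · rw [if_pos h.2, if_pos hx]
    · rw [if_neg h.2, if_neg hx]

theorem pieceOf_eq_of_mem_piece {x : X} {b : ℕ → Bool} {n : ℕ} (h : x ∈ piece V b n) :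
    pieceOf V x n = piece V b n := by
  induction n with
  | zero => rfl
  | succ n ih =>
    rw [piece] at h
    have hx : x ∈ piece V b n := by split_ifs at h <;> exact h.1
    rw [pieceOf, piece, ih hx]
    split_ifs at h with hb
    · rw [if_pos h.2, if_pos hb]
    · rw [if_neg h.2, if_neg hb]

/-- Translates between the two descriptions of a piece, by digits and by a point; equal branches
thus mean equal pieces at all levels. -/
theorem piece_branch (x : X) (n : ℕ) : piece V (branch V x) n = pieceOf V x n := by
  induction n with
  | zero => rfl
  | succ n ih =>
    rw [piece, pieceOf, ih]
    by_cases h : x ∈ V n (pieceOf V x n)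
    · rw [if_pos h, if_pos (by simpa [branch] using h)]
    · rw [if_neg h, if_neg (by simpa [branch] using h)]

theorem branch_eq_of_forall_mem_piece {x : X} {b : ℕ → Bool} (h : ∀ n, x ∈ piece V b n) :
    branch V x = b := by
  funext n
  have h1 := h (n + 1)
  rw [piece] at h1
  rw [branch, pieceOf_eq_of_mem_piece V (h n)]
  split_ifs at h1 with hb
  · simpa [hb] using h1.2
  · simpa [hb] using h1.2

variable {V}

theorem isClopen_piece_and_nonempty [TopologicalSpace X] [Nonempty X]
    (hV : ∀ n U, IsClopen U → U.Nonempty →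
      IsClopen (V n U) ∧ (U ∩ V n U).Nonempty ∧ (U \ V n U).Nonempty)
    (b : ℕ → Bool) (n : ℕ) : IsClopen (piece V b n) ∧ (piece V b n).Nonempty := by
  induction n with
  | zero => exact ⟨isClopen_univ, univ_nonempty⟩
  | succ n ih =>
    obtain ⟨h1, h2, h3⟩ := hV n _ ih.1 ih.2
    rw [piece]
    split_ifs
    · exact ⟨ih.1.inter h1, h2⟩
    · exact ⟨ih.1.diff h1, h3⟩

end CantorScheme

section Cantor

open Set TopologicalSpace

variable {X : Type*} [TopologicalSpace X]

open CantorScheme in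
/-- **Brouwer's theorem**: a nonempty second-countable totally disconnected compact Hausdorff space
without isolated points is homeomorphic to the Cantor space. -/
theorem nonempty_homeomorph_cantorSpace [CompactSpace X] [T2Space X] [TotallyDisconnectedSpace X]
    [SecondCountableTopology X] [Nonempty X] (hX : ∀ x : X, ¬IsOpen ({x} : Set X)) :
    Nonempty (X ≃ₜ (ℕ → Bool)) := by
  have : Countable (Clopens X) := Clopens.countable_iff_secondCountable.2 inferInstance
  -- All clopen sets are enumerated, and the `n`-th cut of a piece follows `C n` whenever `C n` cuts
  -- it; this will separate points.
  obtain ⟨C, hC⟩ := exists_surjective_nat (Clopens X)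
  have key : ∀ (n : ℕ) (U : Set X), ∃ W : Set X, IsClopen U → U.Nonempty →
      IsClopen W ∧ (U ∩ W).Nonempty ∧ (U \ W).Nonempty ∧
      ((∀ x ∈ U, x ∈ W ↔ x ∈ C n) ∨ (∀ x ∈ U, ∀ y ∈ U, x ∈ C n ↔ y ∈ C n)) := fun n U => by
    by_cases h : IsClopen U ∧ U.Nonempty
    · obtain ⟨W, hW⟩ := exists_isClopen_splitting hX (C n).isClopen h.1.isOpen h.2
      exact ⟨W, fun _ _ => hW⟩
    -- A junk value, so that `V` is defined on all sets.
    · exact ⟨∅, fun h1 h2 => (h ⟨h1, h2⟩).elim⟩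
  choose V hV using key
  have hpiece (b : ℕ → Bool) (n : ℕ) : IsClopen (piece V b n) ∧ (piece V b n).Nonempty :=
    isClopen_piece_and_nonempty (fun n U h1 h2 => ⟨(hV n U h1 h2).1, (hV n U h1 h2).2.1,
      (hV n U h1 h2).2.2.1⟩) b n
  have hpieceOf (x : X) (n : ℕ) : IsClopen (pieceOf V x n) ∧ (pieceOf V x n).Nonempty :=
    piece_branch V x n ▸ hpiece (branch V x) n
  have hcont : Continuous (branch V) := by
    refine continuous_pi fun n => ((IsLocallyConstant.iff_eventually_eq _).2 fun x => ?_).continuous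
    have hW := (hV n _ (hpieceOf x n).1 (hpieceOf x n).2).1
    have h1 := (hpieceOf x n).1.isOpen.mem_nhds (mem_pieceOf V x n)
    by_cases hx : x ∈ V n (pieceOf V x n)
    · filter_upwards [h1, hW.isOpen.mem_nhds hx] with y hy hyW
      simp [branch, pieceOf_eq_of_mem V hy, hx, hyW]
    · filter_upwards [h1, hW.compl.isOpen.mem_nhds hx] with y hy hyW
      simpa [branch, pieceOf_eq_of_mem V hy, hx] using hyW
  have hinj : Function.Injective (branch V) := fun x y hxy => by
    by_contra hne
    obtain ⟨W, hW, hxW, hyW⟩ := exists_isClopen_of_totally_separated hne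
    obtain ⟨n, hn⟩ := hC ⟨W, hW⟩
    have hpe (m : ℕ) : pieceOf V x m = pieceOf V y m := by
      rw [← piece_branch, ← piece_branch, hxy]
    have hx := mem_pieceOf V x n
    have hy := hpe n ▸ mem_pieceOf V y n
    have hxC : x ∈ C n := by rw [hn]; exact hxW
    have hyC : y ∉ C n := by rw [hn]; exact hyW
    -- The points share a piece of level `n`. Either digit `n` tells on which side of `C n` they
    -- lie, or the whole piece is on one side; both contradict the separation by `W = C n`.
    obtain h | h := (hV n _ (hpieceOf x n).1 (hpieceOf x n).2).2.2.2
    · have hd := congrFun hxy n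
      simp only [branch, ← hpe n, decide_eq_decide] at hd
      exact hyC ((h y hy).1 (hd.1 ((h x hx).2 hxC)))
    · exact hyC ((h x hx y hy).1 hxC)
  have hsurj : Function.Surjective (branch V) := fun b => by
    -- By compactness the decreasing nonempty closed pieces along `b` have a common point.
    obtain ⟨x, hx⟩ := IsCompact.nonempty_iInter_of_sequence_nonempty_isCompact_isClosed
      (piece V b) (fun n => by rw [piece]; split_ifs; exacts [inter_subset_left, sdiff_subset])
      (fun n => (hpiece b n).2) (hpiece b 0).1.isClosed.isCompact
      (fun n => (hpiece b n).1.isClosed)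
    exact ⟨x, branch_eq_of_forall_mem_piece V (mem_iInter.1 hx)⟩
  exact ⟨hcont.homeoOfEquivCompactToT2 (f := Equiv.ofBijective _ ⟨hinj, hsurj⟩)⟩

end Cantor

/-! ### Counting clopen sets -/

section Clopens

open Set TopologicalSpace

variable {X : Type*} [TopologicalSpace X]

/-- Clopen sets separate points, so a point is determined by the family of clopen sets containing
it. -/
theorem finite_of_finite_clopens [CompactSpace X] [T2Space X] [TotallyDisconnectedSpace X]
    [Finite (Clopens X)] : Finite X := by
  refine Finite.of_injective (fun x => {U : Clopens X | x ∈ U}) fun x y hxy => ?_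
  by_contra hne
  obtain ⟨W, hW, hxW, hyW⟩ := exists_isClopen_of_totally_separated hne
  exact hyW ((Set.ext_iff.1 hxy ⟨W, hW⟩).1 hxW)

theorem card_clopens_of_finite [T2Space X] [Finite X] :
    Nat.card (Clopens X) = 2 ^ Nat.card X := by
  have e : Clopens X ≃ Set X :=
    ⟨fun U => U, fun s => ⟨s, isClopen_discrete s⟩, fun _ => rfl, fun _ => rfl⟩
  rw [Nat.card_congr e]
  simp [Nat.card_eq_fintype_card, Set, Nat.card_fun]

end Clopens

/-! ### The dual of a torsion discrete Abelian group -/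

section Dual

/-- The inclusion of the rational circle `ℚ / ℤ` in `ℝ / ℤ`. -/
noncomputable def ratAddCircleHom : AddCircle (1 : ℚ) →+ AddCircle (1 : ℝ) :=
  QuotientAddGroup.map _ _ (Rat.castHom ℝ).toAddMonoidHom (by
    rintro _ ⟨n, rfl⟩
    exact ⟨n, by simp⟩)

theorem ratAddCircleHom_injective : Function.Injective ratAddCircleHom := by
  rw [injective_iff_map_eq_zero]
  intro x
  induction x using QuotientAddGroup.induction_on with
  | H q =>
    intro h
    have h' : ((q : ℝ) : AddCircle (1 : ℝ)) = 0 := h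
    obtain ⟨n, hn⟩ := (AddCircle.coe_eq_zero_iff 1).1 h'
    refine (AddCircle.coe_eq_zero_iff 1).2 ⟨n, ?_⟩
    simp only [zsmul_eq_mul, mul_one] at hn ⊢
    exact_mod_cast hn

/-- Characters separate the points of an Abelian group. -/
theorem CommGroup.exists_circle_apply_ne_one {G : Type*} [CommGroup G] {g : G} (hg : g ≠ 1) :
    ∃ χ : G →* Circle, χ g ≠ 1 := by
  -- The separating character has values in `ℚ / ℤ`, an injective group; it is then carried to the
  -- circle by injective maps.
  obtain ⟨c, hc⟩ := CharacterModule.exists_character_apply_ne_zero_of_ne_zero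
    (a := Additive.ofMul g) (by simpa using hg)
  refine ⟨⟨⟨fun x => (ratAddCircleHom (c (Additive.ofMul x))).toCircle, by simp⟩,
    fun x y => ?_⟩, ?_⟩
  · simp [AddCircle.toCircle_add]
  · intro h
    apply hc
    apply ratAddCircleHom_injective
    apply AddCircle.injective_toCircle one_ne_zero
    rw [map_zero, AddCircle.toCircle_zero]
    exact h

namespace PontryaginDual

variable {T : Type*} [CommGroup T] [TopologicalSpace T]

theorem continuous_eval_const (t : T) : Continuous fun χ : PontryaginDual T => χ t :=
  ContinuousEvalConst.continuous_eval_const (F := T →ₜ* Circle) t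

/-- Evaluation, as a map from the group to the homomorphisms on its dual. -/
noncomputable def evalHom (t : T) : PontryaginDual T →* ℂˣ :=
  Circle.toUnits.comp ⟨⟨fun χ => χ t, rfl⟩, fun _ _ => rfl⟩

theorem coe_evalHom (t : T) (χ : PontryaginDual T) : (evalHom t χ : ℂ) = χ t := rfl

/-- Evaluation at an element killed by `n` takes values in the finitely many `n`-th roots of unity,
hence is constant on connected sets. -/
theorem totallyDisconnectedSpace (hT : IsMulTorsion T) :
    TotallyDisconnectedSpace (PontryaginDual T) := by
  refine ⟨fun S _ hS χ hχ ψ hψ => ext fun t => ?_⟩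
  obtain ⟨n, hn, ht⟩ := (isOfFinOrder_iff_pow_eq_one).1 (hT t)
  have hfin : {z : ℂ | z ^ n = 1}.Finite := by
    refine (Polynomial.nthRootsFinset n (1 : ℂ)).finite_toSet.subset fun z hz => ?_
    simpa [Polynomial.mem_nthRootsFinset hn] using hz
  have hsub : (fun χ : PontryaginDual T => (χ t : ℂ)) '' S ⊆ {z : ℂ | z ^ n = 1} := by
    rintro _ ⟨φ, -, rfl⟩
    have h : φ t ^ n = 1 := by rw [← map_pow, ht, _root_.map_one]
    simpa using congrArg (fun z : Circle => (z : ℂ)) h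
  have himage := (hS.image _
    (continuous_subtype_val.comp (continuous_eval_const t)).continuousOn)
  exact Subtype.ext ((hfin.subset hsub).countable.isTotallyDisconnected _ subset_rfl himage
    ⟨χ, hχ, rfl⟩ ⟨ψ, hψ, rfl⟩)

variable [DiscreteTopology T]

theorem isEmbedding_coe : Topology.IsEmbedding fun χ : PontryaginDual T => (χ : T → Circle) :=
  (Continuous.isClosedEmbedding (continuous_pi continuous_eval_const)
    DFunLike.coe_injective).isEmbedding

instance [Countable T] : SecondCountableTopology (PontryaginDual T) :=
  isEmbedding_coe.secondCountableTopology

theorem exists_apply_ne_one {t : T} (ht : t ≠ 1) : ∃ χ : PontryaginDual T, χ t ≠ 1 := by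
  obtain ⟨χ, hχ⟩ := CommGroup.exists_circle_apply_ne_one ht
  exact ⟨(⟨χ, continuous_of_discreteTopology⟩ : T →ₜ* Circle), hχ⟩

theorem evalHom_injective : Function.Injective (evalHom (T := T)) := by
  intro s t h
  by_contra hne
  obtain ⟨χ, hχ⟩ := exists_apply_ne_one (t := s * t⁻¹) (by rwa [ne_eq, mul_inv_eq_one])
  apply hχ
  rw [_root_.map_mul, map_inv, mul_inv_eq_one]
  exact Subtype.ext (by rw [← coe_evalHom, h, coe_evalHom])

/-- If the dual is finite, then so is its group of homomorphisms to `ℂˣ`, into which `T` embeds by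
evaluation. -/
theorem finite_iff : Finite (PontryaginDual T) ↔ Finite T := by
  constructor
  · intro h
    have := Fintype.ofFinite (PontryaginDual T)
    have : Finite (PontryaginDual T →* ℂˣ) := inferInstance
    exact Finite.of_injective _ evalHom_injective
  · intro h
    infer_instance

/-- A finite Abelian group `G` has `|G|` homomorphisms to `ℂˣ`. The dual embeds in those of `T`, and
`T` in those of the dual, giving the two inequalities. -/
theorem card_eq [Finite T] : Nat.card (PontryaginDual T) = Nat.card T := by
  have hfin : Finite (PontryaginDual T) := finite_iff.2 inferInstance
  refine le_antisymm ?_ ?_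
  · rw [← CommGroup.card_monoidHom_of_hasEnoughRootsOfUnity T ℂ]
    refine Nat.card_le_card_of_injective
      (fun χ => Circle.toUnits.comp (χ : T →* Circle)) fun χ ψ h => ext fun t => Subtype.ext ?_
    exact congrArg Units.val (DFunLike.congr_fun h t)
  · rw [← CommGroup.card_monoidHom_of_hasEnoughRootsOfUnity (PontryaginDual T) ℂ]
    exact Nat.card_le_card_of_injective _ evalHom_injective

/-- By translation an isolated point would make the dual discrete; being compact, it would be
finite. -/
theorem not_isOpen_singleton [Infinite T] (χ : PontryaginDual T) : ¬IsOpen {χ} := by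
  intro h
  have := discreteTopology_of_isOpen_singleton_one
    (by simpa using (Homeomorph.mulLeft χ).isOpen_preimage.2 h :
      IsOpen ({1} : Set (PontryaginDual T)))
  have : Finite (PontryaginDual T) := finite_of_compact_of_discrete
  exact not_finite_iff_infinite.2 ‹Infinite T› (finite_iff.1 this)

end PontryaginDual

open PontryaginDual in
/-- Countable torsion groups of the same cardinality have homeomorphic duals. -/
theorem nonempty_pontryaginDual_homeomorph {T₁ T₂ : Type*} [CommGroup T₁] [CommGroup T₂]
    [Countable T₁] [Countable T₂] [TopologicalSpace T₁] [DiscreteTopology T₁]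
    [TopologicalSpace T₂] [DiscreteTopology T₂] (hT₁ : IsMulTorsion T₁) (hT₂ : IsMulTorsion T₂)
    (e : T₁ ≃ T₂) : Nonempty (PontryaginDual T₁ ≃ₜ PontryaginDual T₂) := by
  cases finite_or_infinite T₁ with
  | inl h₁ =>
    have h₂ : Finite T₂ := Finite.of_equiv _ e
    have hX₁ : Finite (PontryaginDual T₁) := finite_iff.2 h₁
    have hX₂ : Finite (PontryaginDual T₂) := finite_iff.2 h₂
    have hcard : Nat.card (PontryaginDual T₁) = Nat.card (PontryaginDual T₂) := by
      rw [card_eq, card_eq, Nat.card_congr e]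
    exact (Finite.card_eq.1 hcard).map Homeomorph.ofDiscrete
  | inr h₁ =>
    have h₂ : Infinite T₂ := Infinite.of_injective _ e.injective
    have := totallyDisconnectedSpace hT₁
    have := totallyDisconnectedSpace hT₂
    obtain ⟨f⟩ := nonempty_homeomorph_cantorSpace (not_isOpen_singleton (T := T₁))
    obtain ⟨g⟩ := nonempty_homeomorph_cantorSpace (not_isOpen_singleton (T := T₂))
    exact ⟨f.trans g.symm⟩

end Dual

/-! ### The character space of the group C⋆-algebra of an Abelian group -/

noncomputable section GroupAlgebra

namespace GroupL1

variable {Γ : Type u}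

open Classical in
/-- The point mass at `t`. -/
def single (t : Γ) : GroupL1 Γ :=
  mk (Pi.single t 1) (summable_of_ne_finset_zero (s := {t}) fun x hx => by
    simp only [Finset.mem_singleton] at hx
    simp [hx])

open Classical in
theorem coeff_single (t x : Γ) : (single t).coeff x = if x = t then 1 else 0 := by
  rw [single, coeff_mk, Pi.single_apply]

theorem norm_single (t : Γ) : ‖single t‖ = 1 := by
  classical
  rw [norm_eq, tsum_eq_single t]
  · simp [coeff_single]
  · intro x hx
    simp [coeff_single, hx]

theorem hasSum_coeff_smul_single (f : GroupL1 Γ) :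
    HasSum (fun t => f.coeff t • single t) f := by
  have hs : Summable fun t => f.coeff t • single t := by
    refine Summable.of_norm ?_
    simpa [norm_smul, norm_single] using f.summable_norm
  convert hs.hasSum
  refine ext fun x => ?_
  -- Coefficients are continuous functionals, so the sum of the series can be computed
  -- coefficientwise.
  let ev : GroupL1 Γ →L[ℂ] ℂ := LinearMap.mkContinuous
    ⟨⟨fun f => f.coeff x, fun _ _ => rfl⟩, fun _ _ => rfl⟩ 1 fun f => by
      simpa using! f.norm_coeff_le x
  have h : ev (∑' t, f.coeff t • single t) = ∑' t, f.coeff t * (single t).coeff x :=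
    ev.map_tsum hs
  classical
  change f.coeff x = ev _
  rw [h, tsum_eq_single x]
  · simp [coeff_single]
  · intro y hy
    simp [coeff_single, hy.symm]

variable [Group Γ]

theorem single_one : single (1 : Γ) = 1 := by
  classical
  refine ext fun x => ?_
  simp [coeff_single, coeff_one, Set.indicator_apply]

theorem single_mul_single (s t : Γ) : single (s * t) = single s * single t := by
  classical
  refine ext fun x => ?_
  rw [coeff_mul, tsum_eq_single s]
  · simp [coeff_single, inv_mul_eq_iff_eq_mul]
  · intro y hy
    simp [coeff_single, hy]

theorem star_single (t : Γ) : star (single t) = single t⁻¹ := by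
  classical
  refine ext fun x => ?_
  simp only [coeff_star, coeff_single, inv_eq_iff_eq_inv]
  split_ifs <;> simp

theorem summable_coeff_mul (χ : Γ →* Circle) (f : GroupL1 Γ) :
    Summable fun t => f.coeff t * χ t := by
  refine Summable.of_norm (f.summable_norm.congr fun t => ?_)
  rw [norm_mul, Circle.norm_coe, mul_one]

/-- The character of `ℓ¹(Γ)` induced by a unitary character of `Γ`. -/
def liftCharacter (χ : Γ →* Circle) : GroupL1 Γ →⋆ₐ[ℂ] ℂ :=
  StarAlgHom.mk
    (AlgHom.ofLinearMap
      { toFun := fun f => ∑' t, f.coeff t * χ t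
        map_add' := fun f g => by
          simp only [coeff_add, add_mul]
          exact (summable_coeff_mul χ f).tsum_add (summable_coeff_mul χ g)
        map_smul' := fun c f => by
          simp only [coeff_smul, mul_assoc, tsum_mul_left, smul_eq_mul, RingHom.id_apply] }
      (by
        classical
        change ∑' t, (1 : GroupL1 Γ).coeff t * (χ t : ℂ) = 1
        rw [tsum_eq_single 1]
        · simp [coeff_one]
        · intro t ht
          simp [coeff_one, ht])
      (fun f g => by
        change ∑' t, (f * g).coeff t * (χ t : ℂ) =
          (∑' t, f.coeff t * (χ t : ℂ)) * ∑' t, g.coeff t * (χ t : ℂ)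
        -- Absolute summability, unaffected by the unimodular factor, permits interchanging the
        -- sums; the substitution `t ↦ s * t` then splits them.
        have hs : Summable fun p : Γ × Γ => f.coeff p.1 * g.coeff (p.1⁻¹ * p.2) * (χ p.2 : ℂ) := by
          refine Summable.of_norm ((summable_prod f g).congr fun p => ?_)
          rw [norm_mul _ (χ p.2 : ℂ), Circle.norm_coe, mul_one]
        calc ∑' t, (f * g).coeff t * (χ t : ℂ)
            = ∑' t, ∑' s, f.coeff s * g.coeff (s⁻¹ * t) * (χ t : ℂ) := by
              refine tsum_congr fun t => ?_
              rw [coeff_mul, tsum_mul_right]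
          _ = ∑' s, ∑' t, f.coeff s * g.coeff (s⁻¹ * t) * (χ t : ℂ) := Summable.tsum_comm hs
          _ = ∑' s, f.coeff s * (χ s : ℂ) * ∑' t, g.coeff t * (χ t : ℂ) := by
              refine tsum_congr fun s => ?_
              rw [← tsum_mul_left, ← (Equiv.mulLeft s).tsum_eq]
              refine tsum_congr fun t => ?_
              simp only [Equiv.coe_mulLeft, inv_mul_cancel_left, map_mul, Circle.coe_mul]
              ring
          _ = _ := tsum_mul_right))
    (fun f => by
      change ∑' t, (star f).coeff t * (χ t : ℂ) = star (∑' t, f.coeff t * (χ t : ℂ))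
      rw [tsum_star, ← (Equiv.inv Γ).tsum_eq]
      refine tsum_congr fun t => ?_
      simp [coeff_star, ← Circle.coe_inv_eq_conj])

theorem liftCharacter_apply (χ : Γ →* Circle) (f : GroupL1 Γ) :
    liftCharacter χ f = ∑' t, f.coeff t * χ t := rfl

theorem liftCharacter_single (χ : Γ →* Circle) (t : Γ) : liftCharacter χ (single t) = χ t := by
  classical
  rw [liftCharacter_apply, tsum_eq_single t]
  · simp [coeff_single]
  · intro x hx
    simp [coeff_single, hx]

end GroupL1

/-- The one-dimensional representation given by a character, in the universe of the algebra. -/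
def HilbertRep.ofCharacter {A : Type u} [Ring A] [Algebra ℂ A] [StarRing A] (φ : A →⋆ₐ[ℂ] ℂ) :
    HilbertRep A where
  H := EuclideanSpace ℂ PUnit.{u + 1}
  π := (StarAlgHom.ofId ℂ _).comp φ

theorem HilbertRep.norm_ofCharacter {A : Type u} [Ring A] [Algebra ℂ A] [StarRing A]
    (φ : A →⋆ₐ[ℂ] ℂ) (a : A) : ‖(HilbertRep.ofCharacter φ).π a‖ = ‖φ a‖ := by
  have h := norm_algebraMap' (𝕜 := ℂ)
    (EuclideanSpace ℂ PUnit.{u + 1} →L[ℂ] EuclideanSpace ℂ PUnit.{u + 1}) (φ a)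
  exact h

namespace EnvelopingCStarAlgebra

section Lift

variable {A : Type u} [NormedRing A] [NormedAlgebra ℂ A] [CompleteSpace A] [NormOneClass A]
  [StarRing A] [NormedStarGroup A]

theorem of_one : of (1 : A) = 1 := rfl

theorem norm_of_le (a : A) : ‖of a‖ ≤ ‖a‖ := by
  rw [norm_of]
  exact Real.iSup_le (fun ρ => ρ.norm_le a) (norm_nonneg a)

theorem continuous_of : Continuous (of : A → EnvelopingCStarAlgebra A) :=
  let l : A →ₗ[ℂ] EnvelopingCStarAlgebra A := ⟨⟨of, of_add⟩, of_smul⟩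
  (l.mkContinuous 1 fun a => by simpa using! norm_of_le a).continuous

/-- A character is a one-dimensional representation, so it enters the supremum defining the norm.
This bound lets it extend to the completion. -/
theorem norm_character_le (φ : A →⋆ₐ[ℂ] ℂ) (a : A) : ‖φ a‖ ≤ ‖of a‖ := by
  rw [norm_of, ← envelopingSeminorm_apply, ← HilbertRep.norm_ofCharacter φ a]
  exact (HilbertRep.ofCharacter φ).norm_le_envelopingSeminorm a

/-- Every character of `A` extends to the enveloping C⋆-algebra. -/
theorem exists_characterSpace_of (φ : A →⋆ₐ[ℂ] ℂ) :
    ∃ ψ : WeakDual.characterSpace ℂ (EnvelopingCStarAlgebra A), ∀ a, ψ (of a) = φ a := by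
  let l : EnvelopingPre A →L[ℂ] ℂ :=
    LinearMap.mkContinuous (σ := RingHom.id ℂ)
      ⟨⟨fun a : EnvelopingPre A => φ (show A from a), map_add φ⟩, map_smul φ⟩ 1
      fun a => by
        rw [one_mul]
        exact (norm_character_le φ a).trans_eq (UniformSpace.Completion.norm_coe a)
  let L : UniformSpace.Completion (EnvelopingPre A) →L[ℂ] ℂ :=
    l.extend UniformSpace.Completion.toComplL
  have hL (a : A) : L (of a) = φ a :=
    ContinuousLinearMap.extend_eq l
      (UniformSpace.Completion.denseRange_coe)
      (UniformSpace.Completion.isUniformInducing_coe _) a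
  let L' : EnvelopingCStarAlgebra A →L[ℂ] ℂ := L
  have hmul (x y : EnvelopingCStarAlgebra A) : L' (x * y) = L' x * L' y := by
    refine (denseRange_of A).induction_on₂ (p := fun x y => L' (x * y) = L' x * L' y)
      (isClosed_eq (L'.continuous.comp continuous_mul)
        ((L'.continuous.comp continuous_fst).mul (L'.continuous.comp continuous_snd)))
      (fun a b => ?_) x y
    rw [← of_mul]
    exact (hL _).trans ((map_mul φ a b).trans (by rw [← hL, ← hL]; rfl))
  refine ⟨⟨(L' : WeakDual ℂ (EnvelopingCStarAlgebra A)), fun h0 => ?_, hmul⟩, hL⟩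
  -- The extension is nonzero, as a point of the character space must be, because it is `1` at the
  -- unit.
  have h1 : L' (of 1) = 1 := (hL 1).trans (map_one φ)
  rw [show L' (of 1) = 0 from DFunLike.congr_fun h0 _] at h1
  exact zero_ne_one h1

end Lift

end EnvelopingCStarAlgebra

namespace GroupCStarAlgebra

open EnvelopingCStarAlgebra GroupL1

section Group

variable {Γ : Type u} [Group Γ]

/-- The canonical unitary of `C⋆(Γ)` given by an element of `Γ`. -/
def unitaryOf : Γ →* unitary (GroupCStarAlgebra Γ) where
  toFun t := ⟨of (single t), by
    rw [Unitary.mem_iff, star_of, star_single, ← of_mul, ← of_mul, ← single_mul_single,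
      ← single_mul_single, inv_mul_cancel, mul_inv_cancel, single_one, of_one]
    exact ⟨rfl, rfl⟩⟩
  map_one' := Subtype.ext (by simp only [single_one, of_one]; rfl)
  map_mul' s t := Subtype.ext (by simp only [single_mul_single, of_mul]; rfl)

/-- Point masses span a dense subspace of `ℓ¹(Γ)`, whose image is dense in `C⋆(Γ)`. -/
theorem continuousLinearMap_ext {φ ψ : GroupCStarAlgebra Γ →L[ℂ] ℂ}
    (h : ∀ t, φ (of (single t)) = ψ (of (single t))) : φ = ψ := by
  refine DFunLike.coe_injective ((denseRange_of (GroupL1 Γ)).equalizer φ.continuous ψ.continuous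
    (funext fun f => ?_))
  let l : GroupL1 Γ →L[ℂ] GroupCStarAlgebra Γ := ⟨⟨⟨of, of_add⟩, of_smul⟩, continuous_of⟩
  have hsum (θ : GroupCStarAlgebra Γ →L[ℂ] ℂ) :
      HasSum (fun t => f.coeff t * θ (of (single t))) (θ (of f)) := by
    simpa using! (hasSum_coeff_smul_single f).mapL (θ.comp l)
  have h1 := hsum φ
  simp only [h] at h1
  exact h1.unique (hsum ψ)

end Group

variable {Γ : Type u} [CommGroup Γ]

variable (Γ) in
/-- The group C⋆-algebra of an Abelian group is commutative. -/
abbrev commCStarAlgebra : CommCStarAlgebra (GroupCStarAlgebra Γ) where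
  mul_comm x y := by
    refine (denseRange_of _).induction_on₂ (p := fun x y : GroupCStarAlgebra Γ => x * y = y * x)
      (isClosed_eq continuous_mul (continuous_snd.mul continuous_fst)) (fun f g => ?_) x y
    rw [← of_mul, ← of_mul]
    congr 1
    refine GroupL1.ext fun t => ?_
    -- The substitution `y = t * s⁻¹` exchanges the two factors of the convolution.
    rw [coeff_mul, coeff_mul, ← ((Equiv.inv Γ).trans (Equiv.mulLeft t)).tsum_eq]
    refine tsum_congr fun s => ?_
    simp [mul_comm]

variable [TopologicalSpace Γ] [DiscreteTopology Γ]

open WeakDual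

section CharacterSpace

attribute [local instance] commCStarAlgebra

/-- Restriction of a character of `C⋆(Γ)` to `Γ`. -/
def restrictCharacter (φ : characterSpace ℂ (GroupCStarAlgebra Γ)) : PontryaginDual Γ :=
  (⟨⟨⟨fun t => ⟨φ (unitaryOf t), by
      refine mem_sphere_zero_iff_norm.2 ?_
      exact CStarRing.norm_of_mem_unitary (Unitary.map_mem φ (unitaryOf t).2)⟩,
    Subtype.ext (by simp)⟩,
      fun s t => Subtype.ext (by simp only [map_mul, Submonoid.coe_mul]; rfl)⟩,
    continuous_of_discreteTopology⟩ : Γ →ₜ* Circle)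

/-- Injective because a continuous functional is determined on point masses; surjective because a
unitary character extends first to `ℓ¹(Γ)` by summation, then to the completion. -/
theorem restrictCharacter_bijective :
    Function.Bijective (restrictCharacter (Γ := Γ)) := by
  constructor
  · intro φ ψ h
    have hclm : CharacterSpace.toCLM φ = CharacterSpace.toCLM ψ :=
      continuousLinearMap_ext fun t => by
        have := congrArg Subtype.val (DFunLike.congr_fun h t)
        exact this
    exact CharacterSpace.ext fun x => DFunLike.congr_fun hclm x
  · intro χ
    obtain ⟨ψ, hψ⟩ := exists_characterSpace_of (liftCharacter (χ : Γ →* Circle))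
    refine ⟨ψ, PontryaginDual.ext fun t => Subtype.ext ?_⟩
    exact (hψ _).trans (liftCharacter_single _ t)

theorem continuous_restrictCharacter : Continuous (restrictCharacter (Γ := Γ)) := by
  refine PontryaginDual.isEmbedding_coe.continuous_iff.2 (continuous_pi fun t => ?_)
  exact ((WeakDual.eval_continuous _).comp continuous_subtype_val).subtype_mk _

/-- The character space of `C⋆(Γ)` is the dual group of `Γ`. -/
def characterSpaceHomeomorph :
    characterSpace ℂ (GroupCStarAlgebra Γ) ≃ₜ PontryaginDual Γ :=
  Continuous.homeoOfEquivCompactToT2 (f := Equiv.ofBijective _ restrictCharacter_bijective)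
    continuous_restrictCharacter

end CharacterSpace

variable (Γ) in
/-- The group C⋆-algebra of an Abelian group is the algebra of continuous functions on its dual. -/
def starAlgEquivContinuousMap :
    GroupCStarAlgebra Γ ≃⋆ₐ[ℂ] C(PontryaginDual Γ, ℂ) :=
  letI := commCStarAlgebra Γ
  (gelfandStarTransform (GroupCStarAlgebra Γ)).trans
    (characterSpaceHomeomorph.symm.compStarAlgEquiv' ℂ ℂ)

end GroupCStarAlgebra

end GroupAlgebra

/-! ### Unitary groups -/

section Unitary

open TopologicalSpace

/-- Isomorphic C⋆-algebras have isomorphic topological unitary groups. -/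
def StarAlgEquiv.unitaryContinuousMulEquiv {A B : Type*} [CStarAlgebra A] [CStarAlgebra B]
    (e : A ≃⋆ₐ[ℂ] B) : unitary A ≃ₜ* unitary B where
  __ := (Unitary.mapEquiv ⟨MulEquivClass.toMulEquiv e, map_star e⟩).toMulEquiv
  continuous_toFun :=
    ((StarAlgEquiv.isometry e).continuous.comp continuous_subtype_val).subtype_mk _
  continuous_invFun :=
    ((StarAlgEquiv.isometry e.symm).continuous.comp continuous_subtype_val).subtype_mk _

variable {X : Type*} [TopologicalSpace X]

open Classical in
/-- The symmetry `1 - 2 • 1_U` of `C(X, ℂ)`. -/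
noncomputable def TopologicalSpace.Clopens.symmetry (U : Clopens X) : C(X, ℂ) where
  toFun x := if x ∈ U then -1 else 1
  continuous_toFun := continuous_const.if (fun x hx =>
    ((U.isClopen.frontier_eq ▸ hx : x ∈ (∅ : Set X))).elim) continuous_const

theorem TopologicalSpace.Clopens.symmetry_mul_self (U : Clopens X) :
    U.symmetry * U.symmetry = 1 := by
  ext x
  by_cases hx : x ∈ U <;> simp [symmetry, hx]

theorem TopologicalSpace.Clopens.star_symmetry (U : Clopens X) : star U.symmetry = U.symmetry := by
  ext x
  by_cases hx : x ∈ U <;> simp [symmetry, hx]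

theorem apply_eq_one_or_neg_one_of_sq_eq_one {u : unitary C(X, ℂ)} (hu : u ^ 2 = 1) (x : X) :
    (u : C(X, ℂ)) x = 1 ∨ (u : C(X, ℂ)) x = -1 := by
  have h : (u : C(X, ℂ)) ^ 2 = 1 := congrArg Subtype.val hu
  exact (sq_eq_sq_iff_eq_or_eq_neg.1 ((DFunLike.congr_fun h x).trans (one_pow 2).symm))

open Classical in
/-- The elements of order at most two in the unitary group of `C(X, ℂ)` correspond to the clopen
subsets of `X`. -/
noncomputable def unitarySqEqOneEquivClopens :
    {u : unitary C(X, ℂ) // u ^ 2 = 1} ≃ Clopens X where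
  toFun u := ⟨{x | (u : C(X, ℂ)) x = -1}, by
    refine ⟨isClosed_eq (map_continuous _) continuous_const, ?_⟩
    have : {x | (u : C(X, ℂ)) x = -1} = {x | (u : C(X, ℂ)) x = 1}ᶜ := by
      ext x
      obtain h | h := apply_eq_one_or_neg_one_of_sq_eq_one u.2 x <;> norm_num [h]
    rw [this]
    exact (isClosed_eq (map_continuous _) continuous_const).isOpen_compl⟩
  invFun U := ⟨⟨U.symmetry, by
    rw [Unitary.mem_iff, U.star_symmetry, U.symmetry_mul_self]
    exact ⟨rfl, rfl⟩⟩, Subtype.ext (by simp [sq, U.symmetry_mul_self])⟩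
  left_inv u := by
    refine Subtype.ext (Subtype.ext (ContinuousMap.ext fun x => ?_))
    change (if (u : C(X, ℂ)) x = -1 then (-1 : ℂ) else 1) = (u : C(X, ℂ)) x
    obtain h | h := apply_eq_one_or_neg_one_of_sq_eq_one u.2 x <;> norm_num [h]
  right_inv U := by
    ext x
    change (if x ∈ U then (-1 : ℂ) else 1) = -1 ↔ x ∈ U
    by_cases hx : x ∈ U <;> norm_num [hx]

/-- The unitaries of order at most two in the group C⋆-algebra of an Abelian group correspond to
the clopen subsets of its dual. -/
theorem GroupCStarAlgebra.nonempty_unitarySqEqOne_equiv_clopens {T : Type*} [CommGroup T]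
    [TopologicalSpace T] [DiscreteTopology T] :
    Nonempty ({u : unitary (GroupCStarAlgebra T) // u ^ 2 = 1} ≃ Clopens (PontryaginDual T)) := by
  let e := (starAlgEquivContinuousMap T).unitaryContinuousMulEquiv.toMulEquiv
  exact ⟨(e.toEquiv.subtypeEquiv fun u => by
    change u ^ 2 = 1 ↔ e u ^ 2 = 1
    rw [← map_pow, map_eq_one_iff e e.injective]).trans unitarySqEqOneEquivClopens⟩

/-- A countable torsion group is determined up to cardinality by the group of unitaries of its
group C⋆-algebra. -/
theorem nonempty_equiv_of_unitary_mulEquiv {T₁ T₂ : Type*} [CommGroup T₁] [CommGroup T₂]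
    [Countable T₁] [Countable T₂] [TopologicalSpace T₁] [DiscreteTopology T₁]
    [TopologicalSpace T₂] [DiscreteTopology T₂] (hT₁ : IsMulTorsion T₁) (hT₂ : IsMulTorsion T₂)
    (e : unitary (GroupCStarAlgebra T₁) ≃* unitary (GroupCStarAlgebra T₂)) :
    Nonempty (T₁ ≃ T₂) := by
  have := PontryaginDual.totallyDisconnectedSpace hT₁
  have := PontryaginDual.totallyDisconnectedSpace hT₂
  obtain ⟨e₁⟩ := GroupCStarAlgebra.nonempty_unitarySqEqOne_equiv_clopens (T := T₁)
  obtain ⟨e₂⟩ := GroupCStarAlgebra.nonempty_unitarySqEqOne_equiv_clopens (T := T₂)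
  -- A group isomorphism preserves the solutions of `u ^ 2 = 1`, so the duals have equally many
  -- clopen sets; the topology of the unitary groups plays no role.
  let E : Clopens (PontryaginDual T₁) ≃ Clopens (PontryaginDual T₂) :=
    e₁.symm.trans ((e.toEquiv.subtypeEquiv fun u => by
      change u ^ 2 = 1 ↔ e u ^ 2 = 1
      rw [← map_pow, map_eq_one_iff e e.injective]).trans e₂)
  cases finite_or_infinite T₁ with
  | inl h₁ =>
    have hX₁ : Finite (PontryaginDual T₁) := PontryaginDual.finite_iff.2 h₁
    have : Finite (Clopens (PontryaginDual T₁)) := Finite.of_injective _ SetLike.coe_injective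
    have := Finite.of_equiv _ E
    have hX₂ : Finite (PontryaginDual T₂) := finite_of_finite_clopens
    have h₂ : Finite T₂ := PontryaginDual.finite_iff.1 hX₂
    have hcard := Nat.card_congr E
    rw [card_clopens_of_finite, card_clopens_of_finite, PontryaginDual.card_eq,
      PontryaginDual.card_eq] at hcard
    -- The counts of clopen sets are `2 ^ |T₁|` and `2 ^ |T₂|`.
    exact Finite.card_eq.1 (Nat.pow_right_injective le_rfl hcard)
  | inr h₁ =>
    have h₂ : Infinite T₂ := by
      by_contra h
      rw [not_infinite_iff_finite] at h
      have hX₂ : Finite (PontryaginDual T₂) := PontryaginDual.finite_iff.2 h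
      have : Finite (Clopens (PontryaginDual T₂)) := Finite.of_injective _ SetLike.coe_injective
      have := Finite.of_equiv _ E.symm
      have hX₁ : Finite (PontryaginDual T₁) := finite_of_finite_clopens
      exact not_finite_iff_infinite.2 h₁ (PontryaginDual.finite_iff.1 hX₁)
    obtain ⟨_⟩ := nonempty_denumerable T₁
    obtain ⟨_⟩ := nonempty_denumerable T₂
    exact ⟨Denumerable.equiv₂ T₁ T₂⟩

end Unitary

-- The equivalence of the four assertions

universe v w

theorem mainTheorem5 (T₁ : Type v) (T₂ : Type w)
    [CommGroup T₁] [CommGroup T₂] [Countable T₁] [Countable T₂]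
    [TopologicalSpace T₁] [DiscreteTopology T₁] [TopologicalSpace T₂] [DiscreteTopology T₂]
    (hT₁ : IsMulTorsion T₁) (hT₂ : IsMulTorsion T₂) :
    List.TFAE [
      Nonempty (GroupCStarAlgebra T₁ ≃⋆ₐ[ℂ] GroupCStarAlgebra T₂),
      Nonempty (unitary (GroupCStarAlgebra T₁) ≃ₜ* unitary (GroupCStarAlgebra T₂)),
      Nonempty (PontryaginDual T₁ ≃ₜ PontryaginDual T₂),
      Cardinal.lift.{w} (Cardinal.mk T₁) = Cardinal.lift.{v} (Cardinal.mk T₂)] := by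
  tfae_have 1 → 2 := fun ⟨e⟩ => ⟨e.unitaryContinuousMulEquiv⟩
  tfae_have 2 → 4 := fun ⟨e⟩ =>
    Cardinal.lift_mk_eq'.2 (nonempty_equiv_of_unitary_mulEquiv hT₁ hT₂ e.toMulEquiv)
  tfae_have 4 → 3 := fun h => by
    obtain ⟨e⟩ := Cardinal.lift_mk_eq'.1 h
    exact nonempty_pontryaginDual_homeomorph hT₁ hT₂ e
  tfae_have 3 → 1 := fun ⟨e⟩ =>
    ⟨(GroupCStarAlgebra.starAlgEquivContinuousMap T₁).trans ((e.symm.compStarAlgEquiv' ℂ ℂ).trans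
      (GroupCStarAlgebra.starAlgEquivContinuousMap T₂).symm)⟩
  tfae_finish
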